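/- Let $n\ge 0$ be an integer. For every integer $k\ge 0$ let $$v_k(t)=e^{-\frac{t^{2n+2}}{2n+2}}\,L_k^{\left(-\frac1{2n+2}\right)}\!\left(\frac{t^{2n+2}}{n+1}\right),\qquad L_k^{(a)}(x)=\sum_{i=0}^{k}(-1)^i\binom{k+a}{k-i}\frac{x^i}{i!},$$ which is an even eigenfunction (smooth, not identically zero, exponentially decaying at $\pm\infty$), with eigenvalue $E_k=4k(n+1)+2n+1$, of the problem $-u''+t^{2(2n+1)}u=E\,t^{2n}u$ on $\mathbb R$, and let $\tilde v_k=v_k/\|t^n v_k\|_{L^2(\mathbb R)}$ be the normalized eigenfunction, so that $\|t^n\tilde v_k\|_{L^2(\mathbb R)}=1$. For $a,b>0$ let $S^{a}_{b}(\mathbb R)$ be the Gel'fand–Shilov space of the functions $f\in C^\infty(\mathbb R)$ for which there are positive constants $C,A,B$, depending only on $f$, such that $|t^pf^{(q)}(t)|\le C A^pB^q p^{ap}q^{bq}$ for all integers $p,q\ge0$ and all $t\in\mathbb R$ (with $0^0=1$). Then for every $k\ge 0$ both $v_k$ and $\tilde v_k$ belong to $S^{\frac1{2n+2}}_{\frac{2n+1}{2n+2}}(\mathbb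 R)$. Moreover there is a constant $C_v>0$, depending only on $n$, such that for all integers $k,\alpha,\beta\ge0$ and all $t\in\mathbb R$ $$|t^\alpha\partial_t^\beta v_k(t)|\le C_v^{\,k+\alpha+\beta+1}\,\alpha!^{\frac1{2n+2}}\,\beta!^{\frac{2n+1}{2n+2}},$$ and the same estimate holds with $\tilde v_k$ in place of $v_k$. -/

import Mathlib

open scoped ContDiff Nat

noncomputable section

/-- The generalized Laguerre polynomial
`L_k^{(a)}(x) = ∑_{i ≤ k} (-1)^i binom(k + a, k - i) x^i / i!` with real parameter `a`.
`Ring.choose` is the generalized binomial coefficient `r (r-1) ⋯ (r-j+1) / j!`. -/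
def laguerre (a : ℝ) (k : ℕ) (x : ℝ) : ℝ :=
  ∑ i ∈ Finset.range (k + 1),
    (-1 : ℝ) ^ i * Ring.choose ((k : ℝ) + a) (k - i) * x ^ i / (i ! : ℝ)

/-- The even function
`v_k(t) = exp(-t^{2n+2}/(2n+2)) L_k^{(-1/(2n+2))}(t^{2n+2}/(n+1))`. -/
def evenEigenfunction (n k : ℕ) (t : ℝ) : ℝ :=
  Real.exp (-(t ^ (2 * n + 2) / (2 * (n : ℝ) + 2))) *
    laguerre (-(1 / (2 * (n : ℝ) + 2))) k (t ^ (2 * n + 2) / ((n : ℝ) + 1))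

/-- The function `v_k / ‖t^n v_k‖`, with the norm of `L²(ℝ)`. -/
def normalizedEvenEigenfunction (n k : ℕ) (t : ℝ) : ℝ :=
  evenEigenfunction n k t / Real.sqrt (∫ s : ℝ, (s ^ n * evenEigenfunction n k s) ^ 2)

/-- `u` is an even eigenfunction, with eigenvalue `E`, of the problem
`-u'' + t^{2(2n+1)} u = E t^{2n} u` on `ℝ`, `u` exponentially decaying at `±∞`. -/
structure IsEvenEigenfunction (n : ℕ) (E : ℝ) (u : ℝ → ℝ) : Prop where
  smooth : ContDiff ℝ ∞ u
  even : ∀ t, u (-t) = u t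
  ne_zero : u ≠ 0
  equation : ∀ t, -(iteratedDeriv 2 u t) + t ^ (2 * (2 * n + 1)) * u t = E * t ^ (2 * n) * u t
  decay : ∃ c : ℝ, 0 < c ∧ ∃ M : ℝ, ∀ t, |u t| ≤ M * Real.exp (-(c * |t|))

/-- The Gel'fand-Shilov space `S^a_b(ℝ)` of smooth functions `f` with
`|t^p f^{(q)}(t)| ≤ C A^p B^q p^{a p} q^{b q}` for all `p`, `q`, `t`, where the positive constants
`C`, `A`, `B` depend only on `f`: the upper index governs the powers of `t` and the lower index
the derivatives. For `p = 0` or `q = 0` the convention is `0^0 = 1`, that of `Real.rpow`. -/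
def gelfandShilov (a b : ℝ) : Set (ℝ → ℝ) :=
  {f | ContDiff ℝ ∞ f ∧ ∃ C A B : ℝ, 0 < C ∧ 0 < A ∧ 0 < B ∧ ∀ (p q : ℕ) (t : ℝ),
    |t ^ p * iteratedDeriv q f t| ≤
      C * A ^ p * B ^ q * (p : ℝ) ^ (a * (p : ℝ)) * (q : ℝ) ^ (b * (q : ℝ))}

end

/-!
Write `m = 2n + 2` and `L` for the Laguerre polynomial of parameter `-1/m`, so that
`v_k(t) = exp(-t^m/m) L(2 t^m/m)`. The equation for `v_k` is Laguerre's equation for `L`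
(`laguerrePoly_ode`) after two differentiations (`hasDerivAt_exp_mul_eval`).

The estimates come from Cauchy's inequality for the entire extension of `v_k`. The coefficients of
`L` are at most `2^k / i!` in absolute value, because the parameter is not positive, so that
`|L(w)| ≤ (2/δ)^k exp(δ|w|)` for every `0 < δ ≤ 1` (`norm_aeval_laguerrePoly_le`); as `m` is even,
`Re z^m ≥ t^m/2 - K|z - t|^m` for real `t` (`exists_re_pow_ge`). With `δ` small these give
`|v_k(z)| ≤ D^k exp(-t^m/(4m) + D|z - t|^m)` (`norm_evenEigenfunctionExt_le`). Cauchy's inequality on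
the circle of radius `(q+1)^(1/m)` turns this into
`|v_k^{(q)}(t)| ≤ D^(k+q+1) q!^(1-1/m) exp(-t^m/(4m))`, and the exponential absorbs `t^p` at the
price of `4^p p!^(1/m)` (`abs_pow_mul_exp_le`).

For the normalized functions it remains to bound `‖t^n v_k‖` from below by a geometric sequence
(`integral_sq_pow_mul_evenEigenfunction_ge`). The value of this norm is not needed:
`v_k(0) = binom(k - 1/m, k) ≥ 2^(-k)`, while `v_k'` is at most geometrically large by the estimate
just obtained, so `v_k` is not small on an interval of geometrically small length.
-/

/-! ### Generalized binomial coefficients -/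

theorem ring_choose_succ_mul (r : ℝ) (j : ℕ) :
    Ring.choose r (j + 1) * ((j : ℝ) + 1) = Ring.choose r j * (r - j) := by
  have h1 := Ring.descPochhammer_eq_factorial_smul_choose r j
  have h2 := Ring.descPochhammer_eq_factorial_smul_choose r (j + 1)
  rw [descPochhammer_succ_right, Polynomial.smeval_mul, h1] at h2
  simp only [Polynomial.smeval_sub, Polynomial.smeval_X, Polynomial.smeval_natCast, nsmul_eq_mul,
    pow_one, pow_zero, mul_one, Nat.factorial_succ, Nat.cast_mul, Nat.cast_succ] at h2
  have h3 : ((j ! : ℕ) : ℝ) ≠ 0 := by positivity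
  apply mul_left_cancel₀ h3
  linear_combination -h2

/-- Lowering the upper argument `k` of a binomial coefficient by at most `1/2` decreases it, each
factor `k - l` of the numerator losing at most one half of its size. -/
theorem ring_choose_bounds {a : ℝ} (ha : -(1 / 2) ≤ a) (ha' : a ≤ 0) (k j : ℕ) (hj : j ≤ k) :
    (k.choose j : ℝ) / 2 ^ j ≤ Ring.choose ((k : ℝ) + a) j ∧
      Ring.choose ((k : ℝ) + a) j ≤ k.choose j := by
  induction j with
  | zero => simp
  | succ j ih =>
    obtain ⟨h1, h2⟩ := ih (by omega)
    have hr := ring_choose_succ_mul ((k : ℝ) + a) j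
    have hN : (k.choose (j + 1) : ℝ) * ((j : ℝ) + 1) = k.choose j * ((k : ℝ) - j) := by
      have := Nat.choose_succ_right_eq k j
      rw [← Nat.cast_sub (by omega : j ≤ k)]
      exact_mod_cast this
    have hkj : (1 : ℝ) ≤ (k : ℝ) - j := by
      have : ((j + 1 : ℕ) : ℝ) ≤ k := by exact_mod_cast hj
      push_cast at this
      linarith
    have hj0 : (0 : ℝ) < (j : ℝ) + 1 := by positivity
    have hc0 : (0 : ℝ) ≤ (k.choose j : ℝ) / 2 ^ j := by positivity
    constructor
    · apply le_of_mul_le_mul_right _ hj0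
      rw [hr, pow_succ]
      calc (k.choose (j + 1) : ℝ) / (2 ^ j * 2) * ((j : ℝ) + 1)
          = ((k.choose (j + 1) : ℝ) * ((j : ℝ) + 1)) / (2 ^ j * 2) := by ring
        _ = (k.choose j : ℝ) / 2 ^ j * (((k : ℝ) - j) / 2) := by rw [hN]; field_simp
        _ ≤ Ring.choose ((k : ℝ) + a) j * ((k : ℝ) + a - j) :=
          mul_le_mul h1 (by linarith) (by linarith) (hc0.trans h1)
    · apply le_of_mul_le_mul_right _ hj0
      rw [hr, hN]
      exact mul_le_mul h2 (by linarith) (by linarith) (by positivity)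

/-! ### Laguerre polynomials -/

/-- The function `laguerre a k` as a polynomial. -/
noncomputable def laguerrePoly (a : ℝ) (k : ℕ) : Polynomial ℝ :=
  ∑ i ∈ Finset.range (k + 1),
    Polynomial.monomial i ((-1 : ℝ) ^ i * Ring.choose ((k : ℝ) + a) (k - i) / (i ! : ℝ))

theorem laguerre_eq_eval (a : ℝ) (k : ℕ) (x : ℝ) : laguerre a k x = (laguerrePoly a k).eval x := by
  simp only [laguerre, laguerrePoly, Polynomial.eval_finsetSum, Polynomial.eval_monomial]
  exact Finset.sum_congr rfl fun i _ => by ring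

theorem laguerrePoly_coeff (a : ℝ) (k i : ℕ) :
    (laguerrePoly a k).coeff i =
      if i ≤ k then (-1 : ℝ) ^ i * Ring.choose ((k : ℝ) + a) (k - i) / (i ! : ℝ) else 0 := by
  simp [laguerrePoly, Polynomial.coeff_monomial]

theorem laguerrePoly_coeff_succ (a : ℝ) (k i : ℕ) :
    (laguerrePoly a k).coeff (i + 1) * (((i : ℝ) + 1) * ((i : ℝ) + 1 + a)) =
      ((i : ℝ) - k) * (laguerrePoly a k).coeff i := by
  rw [laguerrePoly_coeff, laguerrePoly_coeff]
  rcases lt_trichotomy i k with h | rfl | h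
  · rw [if_pos (by omega), if_pos h.le]
    obtain ⟨d, rfl⟩ := Nat.exists_eq_add_of_lt h
    have e1 : i + d + 1 - (i + 1) = d := by omega
    have e2 : i + d + 1 - i = d + 1 := by omega
    rw [e1, e2]
    have := ring_choose_succ_mul (((i + d + 1 : ℕ) : ℝ) + a) d
    have h3 : ((i ! : ℕ) : ℝ) ≠ 0 := by positivity
    rw [Nat.factorial_succ]
    push_cast at this ⊢
    have h4 : (i : ℝ) + 1 ≠ 0 := by positivity
    field_simp
    rw [pow_succ]
    linear_combination (-1 : ℝ) ^ i * this
  · simp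
  · rw [if_neg (by omega), if_neg (by omega)]
    simp

/-- Laguerre's equation `x L'' + (a + 1 - x) L' + k L = 0`. -/
theorem laguerrePoly_ode (a : ℝ) (k : ℕ) :
    Polynomial.X * (laguerrePoly a k).derivative.derivative +
      (Polynomial.C (a + 1) - Polynomial.X) * (laguerrePoly a k).derivative +
      Polynomial.C (k : ℝ) * laguerrePoly a k = 0 := by
  ext i
  have h := laguerrePoly_coeff_succ a k i
  cases i with
  | zero =>
    simp [sub_mul, Polynomial.coeff_derivative] at h ⊢
    linear_combination h
  | succ i =>
    simp [sub_mul, Polynomial.coeff_derivative, -map_add] at h ⊢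
    linear_combination h

theorem laguerre_zero_right (a : ℝ) (k : ℕ) : laguerre a k 0 = Ring.choose ((k : ℝ) + a) k := by
  rw [laguerre_eq_eval, ← Polynomial.coeff_zero_eq_eval_zero, laguerrePoly_coeff]
  simp

/-- Since the parameter is not positive, the binomial coefficients in the polynomial are dominated
by those of the integer `k`. -/
theorem abs_laguerrePoly_coeff_le {a : ℝ} (ha : -(1 / 2) ≤ a) (ha' : a ≤ 0) (k i : ℕ) :
    |(laguerrePoly a k).coeff i| ≤ 2 ^ k / (i ! : ℝ) := by
  rw [laguerrePoly_coeff]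
  split_ifs with h
  · obtain ⟨h1, h2⟩ := ring_choose_bounds ha ha' k (k - i) (by omega)
    have h0 : 0 ≤ Ring.choose ((k : ℝ) + a) (k - i) := le_trans (by positivity) h1
    rw [abs_div, abs_mul, abs_pow, abs_neg, abs_one, one_pow, one_mul, abs_of_nonneg h0,
      Nat.abs_cast]
    gcongr
    refine h2.trans ?_
    exact_mod_cast Nat.choose_le_two_pow k (k - i)
  · rw [abs_zero]
    positivity

/-! ### The differential equation -/

theorem param_bounds (n : ℕ) :
    -(1 / 2) ≤ -(1 / (2 * (n : ℝ) + 2)) ∧ -(1 / (2 * (n : ℝ) + 2)) ≤ 0 := by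
  constructor
  · rw [neg_le_neg_iff]
    gcongr
    have : (0 : ℝ) ≤ n := by positivity
    linarith
  · rw [neg_nonpos]
    positivity

theorem evenEigenfunction_contDiff (n k : ℕ) : ContDiff ℝ ∞ (evenEigenfunction n k) := by
  unfold evenEigenfunction
  simp only [laguerre]
  fun_prop

theorem evenEigenfunction_neg (n k : ℕ) (t : ℝ) :
    evenEigenfunction n k (-t) = evenEigenfunction n k t := by
  have : Even (2 * n + 2) := ⟨n + 1, by ring⟩
  simp only [evenEigenfunction, this.neg_pow]

theorem evenEigenfunction_zero_ge (n k : ℕ) : (1 / 2 : ℝ) ^ k ≤ evenEigenfunction n k 0 := by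
  obtain ⟨h1, h2⟩ := param_bounds n
  have := (ring_choose_bounds h1 h2 k k le_rfl).1
  simp only [evenEigenfunction, ne_eq, Nat.add_eq_zero_iff, OfNat.ofNat_ne_zero, and_false,
    not_false_eq_true, zero_pow, zero_div, neg_zero, Real.exp_zero, one_mul, laguerre_zero_right]
  simpa using this

/-- A function `t ↦ exp(-t^m/m) P(2 t^m/m)`, with `m = 2n+2` and `P` a polynomial, has a
derivative of the same kind up to the factor `t^{m-1}`. -/
theorem hasDerivAt_exp_mul_eval (n : ℕ) (P : Polynomial ℝ) (t : ℝ) :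
    HasDerivAt (fun t : ℝ => Real.exp (-(t ^ (2 * n + 2) / (2 * (n : ℝ) + 2))) *
        P.eval (t ^ (2 * n + 2) / ((n : ℝ) + 1)))
      (t ^ (2 * n + 1) * (Real.exp (-(t ^ (2 * n + 2) / (2 * (n : ℝ) + 2))) *
        (2 * P.derivative - P).eval (t ^ (2 * n + 2) / ((n : ℝ) + 1)))) t := by
  have hn : (n : ℝ) + 1 ≠ 0 := by positivity
  have hp := hasDerivAt_pow (2 * n + 2) t
  have h1 := ((hp.div_const (2 * (n : ℝ) + 2)).neg).exp
  have h2 := (P.hasDerivAt (t ^ (2 * n + 2) / ((n : ℝ) + 1))).comp t (hp.div_const ((n : ℝ) + 1))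
  refine (h1.mul h2).congr_deriv ?_
  have e : 2 * n + 2 - 1 = 2 * n + 1 := rfl
  simp only [Function.comp_apply, Pi.neg_apply, Polynomial.eval_sub, Polynomial.eval_mul, e]
  push_cast
  have : Polynomial.eval (t ^ (2 * n + 2) / ((n : ℝ) + 1)) (2 : Polynomial ℝ) = 2 := by simp
  rw [this]
  have h3 : (2 : ℝ) * n + 2 = 2 * (n + 1) := by ring
  rw [h3]
  field_simp
  ring

theorem evenEigenfunction_ode (n k : ℕ) (t : ℝ) :
    -(iteratedDeriv 2 (evenEigenfunction n k) t) +
        t ^ (2 * (2 * n + 1)) * evenEigenfunction n k t =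
      (4 * (k : ℝ) * ((n : ℝ) + 1) + 2 * (n : ℝ) + 1) * t ^ (2 * n) * evenEigenfunction n k t := by
  set P := laguerrePoly (-(1 / (2 * (n : ℝ) + 2))) k with hP
  have hn : (n : ℝ) + 1 ≠ 0 := by positivity
  have hf : evenEigenfunction n k = fun t : ℝ =>
      Real.exp (-(t ^ (2 * n + 2) / (2 * (n : ℝ) + 2))) *
        P.eval (t ^ (2 * n + 2) / ((n : ℝ) + 1)) := by
    funext t
    simp only [evenEigenfunction, laguerre_eq_eval, hP]
  have hd1 : deriv (evenEigenfunction n k) = fun t : ℝ => t ^ (2 * n + 1) *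
      (Real.exp (-(t ^ (2 * n + 2) / (2 * (n : ℝ) + 2))) *
        (2 * P.derivative - P).eval (t ^ (2 * n + 2) / ((n : ℝ) + 1))) := by
    funext t
    rw [hf]
    exact (hasDerivAt_exp_mul_eval n P t).deriv
  have hd2 := ((hasDerivAt_pow (2 * n + 1) t).mul
    (hasDerivAt_exp_mul_eval n (2 * P.derivative - P) t)).deriv
  have hode := congrArg (Polynomial.eval (t ^ (2 * n + 2) / ((n : ℝ) + 1)))
    (laguerrePoly_ode (-(1 / (2 * (n : ℝ) + 2))) k)
  rw [← hP] at hode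
  rw [iteratedDeriv_succ, iteratedDeriv_one, hd1]
  erw [hd2]
  rw [hf]
  have h2 (x : ℝ) : Polynomial.eval x (2 : Polynomial ℝ) = 2 := by simp
  have hc : Polynomial.derivative (2 : Polynomial ℝ) = 0 := Polynomial.derivative_ofNat 2
  have e : 2 * n + 1 - 1 = 2 * n := rfl
  have e3 : (2 : ℝ) * n + 2 = 2 * (n + 1) := by ring
  simp only [Polynomial.eval_sub, Polynomial.eval_mul, Polynomial.eval_add, Polynomial.eval_X,
    Polynomial.eval_C, Polynomial.derivative_sub, Polynomial.derivative_mul, h2, hc, zero_mul,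
    zero_add, e, Polynomial.eval_zero] at hode ⊢
  set E := Real.exp (-(t ^ (2 * n + 2) / (2 * (n : ℝ) + 2)))
  set p0 := P.eval (t ^ (2 * n + 2) / ((n : ℝ) + 1))
  set p1 := P.derivative.eval (t ^ (2 * n + 2) / ((n : ℝ) + 1))
  set p2 := P.derivative.derivative.eval (t ^ (2 * n + 2) / ((n : ℝ) + 1))
  rw [e3] at hode
  field_simp at hode
  push_cast
  have e4 : t ^ (2 * n + 2) = t ^ (2 * n) * t ^ 2 := by ring
  have e5 : t ^ (2 * n + 1) = t ^ (2 * n) * t := by ring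
  have e6 : t ^ (2 * (2 * n + 1)) = (t ^ (2 * n)) ^ 2 * t ^ 2 := by ring
  rw [e4] at hode
  rw [e5, e6]
  linear_combination (-2 * t ^ (2 * n) * E) * hode

/-! ### Growth of the entire extension -/

theorem norm_aeval_laguerrePoly_le {a : ℝ} (ha : -(1 / 2) ≤ a) (ha' : a ≤ 0) (k : ℕ) {δ : ℝ}
    (hδ : 0 < δ) (hδ1 : δ ≤ 1) (w : ℂ) :
    ‖Polynomial.aeval w (laguerrePoly a k)‖ ≤ (2 / δ) ^ k * Real.exp (δ * ‖w‖) := by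
  have hdeg : (laguerrePoly a k).natDegree < k + 1 := by
    rw [Nat.lt_succ_iff, Polynomial.natDegree_le_iff_coeff_eq_zero]
    intro i hi
    rw [laguerrePoly_coeff, if_neg (by omega)]
  rw [Polynomial.aeval_eq_sum_range' hdeg]
  refine (norm_sum_le _ _).trans ?_
  calc ∑ i ∈ Finset.range (k + 1), ‖(laguerrePoly a k).coeff i • w ^ i‖
      ≤ ∑ i ∈ Finset.range (k + 1), (2 / δ) ^ k * ((δ * ‖w‖) ^ i / (i ! : ℝ)) := by
        refine Finset.sum_le_sum fun i hi => ?_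
        have hik : i ≤ k := by simpa [Nat.lt_succ_iff] using hi
        rw [norm_smul, norm_pow, Real.norm_eq_abs]
        calc |(laguerrePoly a k).coeff i| * ‖w‖ ^ i ≤ 2 ^ k / (i ! : ℝ) * ‖w‖ ^ i := by
              gcongr
              exact abs_laguerrePoly_coeff_le ha ha' k i
          _ = 2 ^ k * 1 * ‖w‖ ^ i / (i ! : ℝ) := by ring
          _ ≤ 2 ^ k * (δ ^ i / δ ^ k) * ‖w‖ ^ i / (i ! : ℝ) := by
              gcongr
              rw [one_le_div (by positivity)]
              exact pow_le_pow_of_le_one hδ.le hδ1 hik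
          _ = (2 / δ) ^ k * ((δ * ‖w‖) ^ i / (i ! : ℝ)) := by
              rw [div_pow, mul_pow]
              ring
    _ = (2 / δ) ^ k * ∑ i ∈ Finset.range (k + 1), (δ * ‖w‖) ^ i / (i ! : ℝ) := by
        rw [Finset.mul_sum]
    _ ≤ (2 / δ) ^ k * Real.exp (δ * ‖w‖) := by
        gcongr
        exact Real.sum_le_exp_of_nonneg (by positivity) _

theorem norm_pow_sub_pow_le_of_norm_le {z w : ℂ} {R : ℝ} (hz : ‖z‖ ≤ R) (hw : ‖w‖ ≤ R) (m : ℕ) :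
    ‖z ^ (m + 1) - w ^ (m + 1)‖ ≤ ((m : ℝ) + 1) * R ^ m * ‖z - w‖ := by
  have hR : 0 ≤ R := (norm_nonneg z).trans hz
  induction m with
  | zero => simp
  | succ m ih =>
    have e : z ^ (m + 1 + 1) - w ^ (m + 1 + 1) =
        z ^ (m + 1) * (z - w) + (z ^ (m + 1) - w ^ (m + 1)) * w := by ring
    rw [e]
    calc _ ≤ ‖z‖ ^ (m + 1) * ‖z - w‖ + ‖z ^ (m + 1) - w ^ (m + 1)‖ * ‖w‖ := by
          refine (norm_add_le _ _).trans ?_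
          rw [norm_mul, norm_mul, norm_pow]
      _ ≤ R ^ (m + 1) * ‖z - w‖ + (((m : ℝ) + 1) * R ^ m * ‖z - w‖) * R := by gcongr
      _ = _ := by push_cast; ring

/-- Near the real axis the real part of `z ^ m`, for `m` even, stays comparable with `t ^ m`, up
to the `m`-th power of the distance from `z` to the real number `t`. -/
theorem exists_re_pow_ge (n : ℕ) : ∃ K : ℝ, 0 ≤ K ∧ ∀ (t : ℝ) (z : ℂ),
    t ^ (2 * n + 2) / 2 - K * ‖z - t‖ ^ (2 * n + 2) ≤ (z ^ (2 * n + 2)).re := by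
  -- If `‖z - t‖ ≤ δ |t|` the difference of the powers is absorbed into `t ^ m / 2`; otherwise `|t|`
  -- itself is bounded by `‖z - t‖ / δ`.
  set δ : ℝ := 1 / ((2 * (n : ℝ) + 2) * 2 ^ (2 * n + 2)) with hδ
  have hδ0 : 0 < δ := by positivity
  have hδ1 : δ ≤ 1 := by
    rw [hδ, div_le_one (by positivity)]
    have h1 : (1 : ℝ) ≤ 2 * (n : ℝ) + 2 := by
      have : (0 : ℝ) ≤ n := by positivity
      linarith
    have h2 : (1 : ℝ) ≤ 2 ^ (2 * n + 2) := one_le_pow₀ (by norm_num)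
    nlinarith
  refine ⟨(2 * (n : ℝ) + 2) * (1 / δ + 1) ^ (2 * n + 1), by positivity, fun t z => ?_⟩
  set r := ‖z - t‖ with hr
  have hr0 : 0 ≤ r := norm_nonneg _
  have heven : Even (2 * n + 2) := ⟨n + 1, by ring⟩
  have ht : (|t|) ^ (2 * n + 2) = t ^ (2 * n + 2) := heven.pow_abs t
  have hz : ‖z‖ ≤ |t| + r := by
    have := norm_add_le (t : ℂ) (z - t)
    rwa [add_sub_cancel, Complex.norm_real, Real.norm_eq_abs] at this
  have hw : ‖(t : ℂ)‖ ≤ |t| + r := by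
    rw [Complex.norm_real, Real.norm_eq_abs]
    linarith
  have hdiff : t ^ (2 * n + 2) - (z ^ (2 * n + 2)).re ≤
      (2 * (n : ℝ) + 2) * (|t| + r) ^ (2 * n + 1) * r := by
    have h1 := norm_pow_sub_pow_le_of_norm_le hz hw (2 * n + 1)
    have h2 := (abs_le.mp (Complex.abs_re_le_norm (z ^ (2 * n + 2) - (t : ℂ) ^ (2 * n + 2)))).1
    have h3 : ((t : ℂ) ^ (2 * n + 2)).re = t ^ (2 * n + 2) := by
      rw [← Complex.ofReal_pow, Complex.ofReal_re]
    rw [Complex.sub_re, h3] at h2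
    push_cast at h1
    have e : 2 * (n : ℝ) + 1 + 1 = 2 * n + 2 := by ring
    rw [e, show 2 * n + 1 + 1 = 2 * n + 2 from rfl] at h1
    linarith
  rcases le_total r (δ * |t|) with h | h
  · have : (2 * (n : ℝ) + 2) * (|t| + r) ^ (2 * n + 1) * r ≤ t ^ (2 * n + 2) / 2 := by
      calc (2 * (n : ℝ) + 2) * (|t| + r) ^ (2 * n + 1) * r
          ≤ (2 * (n : ℝ) + 2) * (|t| + 1 * |t|) ^ (2 * n + 1) * (δ * |t|) := by
            gcongr
            exact h.trans (by gcongr)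
        _ = |t| ^ (2 * n + 2) * (((2 * (n : ℝ) + 2) * 2 ^ (2 * n + 2)) * δ) / 2 := by
            rw [show |t| + 1 * |t| = 2 * |t| by ring, mul_pow]
            ring
        _ = t ^ (2 * n + 2) / 2 := by
            rw [ht, hδ, mul_one_div_cancel (by positivity), mul_one]
    have h4 : 0 ≤ (2 * (n : ℝ) + 2) * (1 / δ + 1) ^ (2 * n + 1) * r ^ (2 * n + 2) := by positivity
    linarith
  · have h5 : |t| ≤ 1 / δ * r := by
      rw [one_div, inv_mul_eq_div, le_div_iff₀ hδ0]
      linarith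
    have : (2 * (n : ℝ) + 2) * (|t| + r) ^ (2 * n + 1) * r ≤
        (2 * (n : ℝ) + 2) * (1 / δ + 1) ^ (2 * n + 1) * r ^ (2 * n + 2) := by
      calc _ ≤ (2 * (n : ℝ) + 2) * (1 / δ * r + r) ^ (2 * n + 1) * r := by gcongr
        _ = (2 * (n : ℝ) + 2) * ((1 / δ + 1) * r) ^ (2 * n + 1) * r := by ring
        _ = _ := by rw [mul_pow]; ring
    have h6 : 0 ≤ t ^ (2 * n + 2) := heven.pow_nonneg t
    linarith

/-- The extension of `evenEigenfunction n k` to an entire function. -/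
noncomputable def evenEigenfunctionExt (n k : ℕ) (z : ℂ) : ℂ :=
  Complex.exp (-(z ^ (2 * n + 2) / (2 * (n : ℂ) + 2))) *
    Polynomial.aeval (z ^ (2 * n + 2) / ((n : ℂ) + 1)) (laguerrePoly (-(1 / (2 * (n : ℝ) + 2))) k)

theorem evenEigenfunctionExt_ofReal (n k : ℕ) (t : ℝ) :
    evenEigenfunctionExt n k t = (evenEigenfunction n k t : ℂ) := by
  have e : ((t : ℂ) ^ (2 * n + 2) / ((n : ℂ) + 1)) =
      algebraMap ℝ ℂ (t ^ (2 * n + 2) / ((n : ℝ) + 1)) := by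
    simp
  rw [evenEigenfunctionExt, e, Polynomial.aeval_algebraMap_apply_eq_algebraMap_eval,
    evenEigenfunction, laguerre_eq_eval]
  simp

theorem differentiable_evenEigenfunctionExt (n k : ℕ) :
    Differentiable ℂ (evenEigenfunctionExt n k) := by
  unfold evenEigenfunctionExt
  have h : Differentiable ℂ fun z : ℂ => z ^ (2 * n + 2) / ((n : ℂ) + 1) := by fun_prop
  have h2 := (Polynomial.differentiable_aeval
    (laguerrePoly (-(1 / (2 * (n : ℝ) + 2))) k) (𝕜 := ℂ)).comp h
  have h3 : Differentiable ℂ fun z : ℂ =>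
    Complex.exp (-(z ^ (2 * n + 2) / (2 * (n : ℂ) + 2))) := by fun_prop
  exact h3.mul h2

/-- On the real line the real derivatives of a function are the real parts of the complex
derivatives of its entire extension. -/
theorem iteratedDeriv_eq_re {F : ℂ → ℂ} (hF : Differentiable ℂ F) {f : ℝ → ℝ}
    (h : ∀ t : ℝ, f t = (F t).re) (q : ℕ) (t : ℝ) :
    iteratedDeriv q f t = (iteratedDeriv q F t).re := by
  induction q generalizing t with
  | zero => simpa using h t
  | succ q ih =>
    rw [iteratedDeriv_succ, funext ih, iteratedDeriv_succ]
    have hd : Differentiable ℂ (iteratedDeriv q F) :=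
      (hF.contDiff (n := ((q + 1 : ℕ) : WithTop ℕ∞))).differentiable_iteratedDeriv q
        (by exact_mod_cast Nat.lt_succ_self q)
    exact ((hd t).hasDerivAt.real_of_complex).deriv

theorem norm_evenEigenfunctionExt_le (n : ℕ) : ∃ D : ℝ, 1 ≤ D ∧ ∀ (k : ℕ) (t : ℝ) (z : ℂ),
    ‖evenEigenfunctionExt n k z‖ ≤ D ^ k * Real.exp (-(t ^ (2 * n + 2) / (8 * (n : ℝ) + 8)) +
      D * ‖z - t‖ ^ (2 * n + 2)) := by
  obtain ⟨K, hK, hre⟩ := exists_re_pow_ge n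
  -- The loss `δ 2^m / (n+1) = 1 / (4 m)` in the exponent is half of the gain `1 / (2 m)`.
  set δ : ℝ := 1 / (8 * 2 ^ (2 * n + 2)) with hδ
  have hδ0 : 0 < δ := by positivity
  have hone : (1 : ℝ) ≤ 2 ^ (2 * n + 2) := one_le_pow₀ (by norm_num)
  have hδ1 : δ ≤ 1 := by
    rw [hδ, div_le_one (by positivity)]
    linarith
  have hn : (0 : ℝ) < (n : ℝ) + 1 := by positivity
  have h2δ : 0 < 2 / δ := by positivity
  refine ⟨2 / δ + K + 1, by linarith, fun k t z => ?_⟩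
  set r := ‖z - t‖ with hr
  have hr0 : 0 ≤ r := norm_nonneg _
  have heven : Even (2 * n + 2) := ⟨n + 1, by ring⟩
  have ht : (|t|) ^ (2 * n + 2) = t ^ (2 * n + 2) := heven.pow_abs t
  have ht0 : 0 ≤ t ^ (2 * n + 2) := heven.pow_nonneg t
  have hz : ‖z‖ ≤ |t| + r := by
    have := norm_add_le (t : ℂ) (z - t)
    rwa [add_sub_cancel, Complex.norm_real, Real.norm_eq_abs] at this
  have hzm : ‖z‖ ^ (2 * n + 2) ≤ 2 ^ (2 * n + 2) * (t ^ (2 * n + 2) + r ^ (2 * n + 2)) := by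
    calc ‖z‖ ^ (2 * n + 2) ≤ (|t| + r) ^ (2 * n + 2) := by gcongr
      _ ≤ 2 ^ (2 * n + 2 - 1) * (|t| ^ (2 * n + 2) + r ^ (2 * n + 2)) :=
        add_pow_le (abs_nonneg t) hr0 _
      _ ≤ 2 ^ (2 * n + 2) * (|t| ^ (2 * n + 2) + r ^ (2 * n + 2)) := by
        gcongr
        · norm_num
        · omega
      _ = _ := by rw [ht]
  obtain ⟨h1, h2⟩ := param_bounds n
  have hL := norm_aeval_laguerrePoly_le h1 h2 k hδ0 hδ1 (z ^ (2 * n + 2) / ((n : ℂ) + 1))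
  have hnn : ‖z ^ (2 * n + 2) / ((n : ℂ) + 1)‖ = ‖z‖ ^ (2 * n + 2) / ((n : ℝ) + 1) := by
    rw [norm_div, norm_pow]
    congr 1
    exact_mod_cast Complex.norm_natCast (n + 1)
  have hexp : ‖Complex.exp (-(z ^ (2 * n + 2) / (2 * (n : ℂ) + 2)))‖ =
      Real.exp (-((z ^ (2 * n + 2)).re / (2 * (n : ℝ) + 2))) := by
    rw [Complex.norm_exp, Complex.neg_re]
    congr 2
    have : (2 * (n : ℂ) + 2) = ((2 * (n : ℝ) + 2 : ℝ) : ℂ) := by push_cast; ring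
    rw [this, Complex.div_ofReal_re]
  have hre' := hre t z
  rw [evenEigenfunctionExt, norm_mul, hexp]
  calc _ ≤ Real.exp (-((z ^ (2 * n + 2)).re / (2 * (n : ℝ) + 2))) * ((2 / δ) ^ k *
        Real.exp (δ * (‖z‖ ^ (2 * n + 2) / ((n : ℝ) + 1)))) := by
        rw [hnn] at hL
        gcongr
    _ = (2 / δ) ^ k * Real.exp (-((z ^ (2 * n + 2)).re / (2 * (n : ℝ) + 2)) +
        δ * (‖z‖ ^ (2 * n + 2) / ((n : ℝ) + 1))) := by
        rw [Real.exp_add]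
        ring
    _ ≤ _ := by
        refine mul_le_mul (pow_le_pow_left₀ h2δ.le (by linarith) k) (Real.exp_le_exp.mpr ?_)
          (Real.exp_nonneg _) (pow_nonneg (by linarith) k)
        have hA : -((z ^ (2 * n + 2)).re / (2 * (n : ℝ) + 2)) ≤
            -((t ^ (2 * n + 2) / 2 - K * r ^ (2 * n + 2)) / (2 * (n : ℝ) + 2)) := by gcongr
        have hB : δ * (‖z‖ ^ (2 * n + 2) / ((n : ℝ) + 1)) ≤
            (t ^ (2 * n + 2) + r ^ (2 * n + 2)) / (8 * ((n : ℝ) + 1)) := by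
          calc _ ≤ δ * ((2 ^ (2 * n + 2) * (t ^ (2 * n + 2) + r ^ (2 * n + 2))) /
                ((n : ℝ) + 1)) := by gcongr
            _ = _ := by rw [hδ]; field_simp
        have hC : -((t ^ (2 * n + 2) / 2 - K * r ^ (2 * n + 2)) / (2 * (n : ℝ) + 2)) +
            (t ^ (2 * n + 2) + r ^ (2 * n + 2)) / (8 * ((n : ℝ) + 1)) =
            -(t ^ (2 * n + 2) / (8 * (n : ℝ) + 8)) +
              (K / (2 * (n : ℝ) + 2) + 1 / (8 * ((n : ℝ) + 1))) * r ^ (2 * n + 2) := by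
          rw [show 2 * (n : ℝ) + 2 = 2 * (n + 1) by ring, show 8 * (n : ℝ) + 8 = 8 * (n + 1) by ring]
          field_simp
          ring
        have hn0 : (0 : ℝ) ≤ n := by positivity
        have hD : K / (2 * (n : ℝ) + 2) + 1 / (8 * ((n : ℝ) + 1)) ≤ 2 / δ + K + 1 := by
          have i1 : K / (2 * (n : ℝ) + 2) ≤ K := div_le_self hK (by linarith)
          have i2 : 1 / (8 * ((n : ℝ) + 1)) ≤ 1 := by
            rw [div_le_one (by positivity)]
            linarith
          linarith
        have hE := mul_le_mul_of_nonneg_right hD (pow_nonneg hr0 (2 * n + 2))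
        linarith

/-! ### Estimates of the derivatives -/

/-- Cauchy's estimate on the circle of radius `(q + 1) ^ (1 / m)` about `t`, `m = 2n + 2`: this
choice balances `r ^ (-q)` against `exp (D r ^ m)`. -/
theorem abs_iteratedDeriv_evenEigenfunction_le (n : ℕ) : ∃ D : ℝ, 1 ≤ D ∧ ∀ (k q : ℕ) (t : ℝ),
    |iteratedDeriv q (evenEigenfunction n k) t| ≤
      D ^ (k + q + 1) * (q ! : ℝ) ^ ((2 * (n : ℝ) + 1) / (2 * (n : ℝ) + 2)) *
        Real.exp (-(t ^ (2 * n + 2) / (8 * (n : ℝ) + 8))) := by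
  obtain ⟨D, hD1, hD⟩ := norm_evenEigenfunctionExt_le n
  have hDe : D ≤ Real.exp D := by linarith [Real.add_one_le_exp D]
  refine ⟨Real.exp D, hD1.trans hDe, fun k q t => ?_⟩
  have hm : (2 * (n : ℝ) + 2) ≠ 0 := by positivity
  set r : ℝ := ((q : ℝ) + 1) ^ (1 / (2 * (n : ℝ) + 2)) with hr
  have hr0 : 0 < r := by positivity
  have hrm : r ^ (2 * n + 2) = (q : ℝ) + 1 := by
    rw [hr, ← Real.rpow_natCast, ← Real.rpow_mul (by positivity)]
    push_cast
    rw [one_div_mul_cancel hm, Real.rpow_one]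
  have hdiff := differentiable_evenEigenfunctionExt n k
  have hC := Complex.norm_iteratedDeriv_le_of_forall_mem_sphere_norm_le (c := (t : ℂ)) q hr0
    hdiff.diffContOnCl (fun z hz => by
      have h := hD k t z
      rw [mem_sphere_iff_norm.mp hz, hrm] at h
      exact h)
  rw [iteratedDeriv_eq_re hdiff (fun s => by rw [evenEigenfunctionExt_ofReal, Complex.ofReal_re])]
  refine (Complex.abs_re_le_norm _).trans (hC.trans ?_)
  have hq : (0 : ℝ) < (q ! : ℝ) := by positivity
  have hrq : (q ! : ℝ) ^ (1 / (2 * (n : ℝ) + 2)) ≤ r ^ q := by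
    rw [hr, ← Real.rpow_natCast, ← Real.rpow_mul (by positivity), mul_comm _ (q : ℝ),
      Real.rpow_mul (by positivity), Real.rpow_natCast]
    refine Real.rpow_le_rpow hq.le ?_ (by positivity)
    have : q ! ≤ (q + 1) ^ q := (Nat.factorial_le_pow q).trans (Nat.pow_le_pow_left (by omega) q)
    exact_mod_cast this
  have hsplit : (q ! : ℝ) = (q ! : ℝ) ^ ((2 * (n : ℝ) + 1) / (2 * (n : ℝ) + 2)) *
      (q ! : ℝ) ^ (1 / (2 * (n : ℝ) + 2)) := by
    rw [← Real.rpow_add hq, ← add_div, show 2 * (n : ℝ) + 1 + 1 = 2 * n + 2 by ring, div_self hm,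
      Real.rpow_one]
  have hquot : (q ! : ℝ) / r ^ q ≤ (q ! : ℝ) ^ ((2 * (n : ℝ) + 1) / (2 * (n : ℝ) + 2)) := by
    rw [div_le_iff₀ (by positivity)]
    nth_rewrite 1 [hsplit]
    gcongr
  calc (q ! : ℝ) * (D ^ k * Real.exp (-(t ^ (2 * n + 2) / (8 * (n : ℝ) + 8)) +
        D * ((q : ℝ) + 1))) / r ^ q
      = D ^ k * Real.exp D ^ (q + 1) * ((q ! : ℝ) / r ^ q) *
        Real.exp (-(t ^ (2 * n + 2) / (8 * (n : ℝ) + 8))) := by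
        rw [Real.exp_add, ← Real.exp_nat_mul]
        push_cast
        rw [mul_comm D]
        ring
    _ ≤ Real.exp D ^ k * Real.exp D ^ (q + 1) *
        (q ! : ℝ) ^ ((2 * (n : ℝ) + 1) / (2 * (n : ℝ) + 2)) *
        Real.exp (-(t ^ (2 * n + 2) / (8 * (n : ℝ) + 8))) := by gcongr
    _ = _ := by rw [← pow_add, add_assoc]

theorem abs_pow_mul_exp_le (n p : ℕ) (t : ℝ) :
    |t| ^ p * Real.exp (-(t ^ (2 * n + 2) / (8 * (n : ℝ) + 8))) ≤
      4 ^ p * (p ! : ℝ) ^ (1 / (2 * (n : ℝ) + 2)) := by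
  have heven : Even (2 * n + 2) := ⟨n + 1, by ring⟩
  have ht : (|t|) ^ (2 * n + 2) = t ^ (2 * n + 2) := heven.pow_abs t
  have ht0 : 0 ≤ t ^ (2 * n + 2) := heven.pow_nonneg t
  have hm : (2 * (n : ℝ) + 2) ≠ 0 := by positivity
  have h8 : (8 * (n : ℝ) + 8) ≠ 0 := by positivity
  -- Compare the powers of exponent `2n + 2`; with `s = t ^ (2n + 2)` the claim becomes
  -- `s ^ p exp (-s / 4) ≤ 4 ^ p p!`.
  have hexp := Real.pow_div_factorial_le_exp (t ^ (2 * n + 2) / 4) (by positivity) p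
  rw [div_le_iff₀ (by positivity)] at hexp
  refine le_of_pow_le_pow_left₀ (n := 2 * n + 2) (by omega) (by positivity) ?_
  have e1 : Real.exp (-(t ^ (2 * n + 2) / (8 * (n : ℝ) + 8))) ^ (2 * n + 2) =
      Real.exp (-(t ^ (2 * n + 2) / 4)) := by
    rw [← Real.exp_nat_mul]
    congr 1
    push_cast
    field_simp
    ring
  have e2 : ((p ! : ℝ) ^ (1 / (2 * (n : ℝ) + 2))) ^ (2 * n + 2) = (p ! : ℝ) := by
    rw [← Real.rpow_natCast, ← Real.rpow_mul (by positivity)]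
    push_cast
    rw [one_div_mul_cancel hm, Real.rpow_one]
  rw [mul_pow, mul_pow, e1, e2, ← pow_mul, mul_comm p, pow_mul, ht]
  calc (t ^ (2 * n + 2)) ^ p * Real.exp (-(t ^ (2 * n + 2) / 4))
      = 4 ^ p * (t ^ (2 * n + 2) / 4) ^ p * Real.exp (-(t ^ (2 * n + 2) / 4)) := by
        rw [← mul_pow]
        congr 2
        ring
    _ ≤ 4 ^ p * (Real.exp (t ^ (2 * n + 2) / 4) * (p ! : ℝ)) *
        Real.exp (-(t ^ (2 * n + 2) / 4)) := by gcongr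
    _ = 4 ^ p * (p ! : ℝ) := by
        rw [Real.exp_neg]
        field_simp
    _ ≤ (4 ^ p) ^ (2 * n + 2) * (p ! : ℝ) := by
        gcongr
        exact le_self_pow₀ (one_le_pow₀ (by norm_num)) (by omega)

theorem abs_pow_mul_iteratedDeriv_evenEigenfunction_le (n : ℕ) :
    ∃ C : ℝ, 1 ≤ C ∧ ∀ (k p q : ℕ) (t : ℝ),
      |t ^ p * iteratedDeriv q (evenEigenfunction n k) t| ≤
        C ^ (k + p + q + 1) * (p ! : ℝ) ^ (1 / (2 * (n : ℝ) + 2)) *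
          (q ! : ℝ) ^ ((2 * (n : ℝ) + 1) / (2 * (n : ℝ) + 2)) := by
  obtain ⟨D, hD1, hD⟩ := abs_iteratedDeriv_evenEigenfunction_le n
  refine ⟨D + 4, by linarith, fun k p q t => ?_⟩
  have h2 := abs_pow_mul_exp_le n p t
  set E := Real.exp (-(t ^ (2 * n + 2) / (8 * (n : ℝ) + 8)))
  set P := (p ! : ℝ) ^ (1 / (2 * (n : ℝ) + 2))
  set Q := (q ! : ℝ) ^ ((2 * (n : ℝ) + 1) / (2 * (n : ℝ) + 2))
  have hP : 0 ≤ P := by positivity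
  have hQ : 0 ≤ Q := by positivity
  rw [abs_mul, abs_pow]
  calc |t| ^ p * |iteratedDeriv q (evenEigenfunction n k) t|
      ≤ |t| ^ p * (D ^ (k + q + 1) * Q * E) := by
        gcongr
        exact hD k q t
    _ = D ^ (k + q + 1) * Q * (|t| ^ p * E) := by ring
    _ ≤ (D + 4) ^ (k + q + 1) * Q * ((D + 4) ^ p * P) := by
        refine mul_le_mul ?_ (h2.trans ?_) (by positivity) (by positivity)
        · gcongr
          linarith
        · gcongr
          linarith
    _ = (D + 4) ^ (k + p + q + 1) * P * Q := by
        rw [show k + p + q + 1 = (k + q + 1) + p by ring, pow_add]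
        ring

/-! ### The norm of `t ^ n v_k` -/

theorem integrable_sq_pow_mul_evenEigenfunction (n k : ℕ) :
    MeasureTheory.Integrable fun t : ℝ => (t ^ n * evenEigenfunction n k t) ^ 2 := by
  obtain ⟨C, -, hC⟩ := abs_pow_mul_iteratedDeriv_evenEigenfunction_le n
  obtain ⟨a, ha⟩ : ∃ a, ∀ t, |t ^ n * evenEigenfunction n k t| ≤ a :=
    ⟨_, fun t => by simpa only [iteratedDeriv_zero] using hC k n 0 t⟩
  obtain ⟨b, hb⟩ : ∃ b, ∀ t, |t ^ (n + 1) * evenEigenfunction n k t| ≤ b :=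
    ⟨_, fun t => by simpa only [iteratedDeriv_zero] using hC k (n + 1) 0 t⟩
  have hcont : Continuous fun t : ℝ => (t ^ n * evenEigenfunction n k t) ^ 2 := by
    have := (evenEigenfunction_contDiff n k).continuous
    fun_prop
  refine (integrable_inv_one_add_sq.const_mul (a ^ 2 + b ^ 2)).mono' hcont.aestronglyMeasurable
    (Filter.Eventually.of_forall fun t => ?_)
  rw [Real.norm_of_nonneg (sq_nonneg _), ← div_eq_mul_inv, le_div_iff₀ (by positivity)]
  have h1 := sq_le_sq' (abs_le.mp (ha t)).1 (abs_le.mp (ha t)).2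
  have h2 := sq_le_sq' (abs_le.mp (hb t)).1 (abs_le.mp (hb t)).2
  calc _ = (t ^ n * evenEigenfunction n k t) ^ 2 +
        (t ^ (n + 1) * evenEigenfunction n k t) ^ 2 := by ring
    _ ≤ _ := add_le_add h1 h2

/-- The norm of `t ^ n v_k` decays at most geometrically in `k`: since `v_k(0) ≥ 2 ^ (-k)` and
`v_k'` is at most geometrically large, `v_k` stays large on an interval of geometrically small
length. -/
theorem integral_sq_pow_mul_evenEigenfunction_ge (n : ℕ) : ∃ c : ℝ, 1 ≤ c ∧ ∀ k : ℕ,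
    ((c ^ (k + 1))⁻¹) ^ 2 ≤ ∫ t : ℝ, (t ^ n * evenEigenfunction n k t) ^ 2 := by
  obtain ⟨C, hC1, hC⟩ := abs_pow_mul_iteratedDeriv_evenEigenfunction_le n
  -- The interval below has length `η = (2 C) ^ (-2 (k + 1))`; it stays away from the zero of `t ^ n`.
  refine ⟨(2 * C) ^ (2 * n + 2), one_le_pow₀ (by linarith), fun k => ?_⟩
  set v := evenEigenfunction n k with hv
  set B : ℝ := (2 * C) ^ (k + 1) with hB
  have hB0 : 0 < B := by positivity
  set η : ℝ := (B ^ 2)⁻¹ with hη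
  have hη0 : 0 < η := by positivity
  have hsmall : C ^ (k + 2) * (2 * η) ≤ (1 / 2) ^ (k + 1) := by
    have h1 : C ^ (k + 2) * 2 * 2 ^ (k + 1) ≤ B ^ 2 := by
      calc C ^ (k + 2) * 2 * 2 ^ (k + 1) = C ^ (k + 2) * 2 ^ (k + 2) := by ring
        _ = (2 * C) ^ (k + 2) := by rw [← mul_pow, mul_comm]
        _ ≤ (2 * C) ^ ((k + 1) * 2) := pow_le_pow_right₀ (by linarith) (by omega)
        _ = B ^ 2 := by rw [hB, pow_mul]
    rw [hη, one_div, inv_pow, ← mul_assoc, ← div_eq_mul_inv, div_le_iff₀ (by positivity),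
      inv_mul_eq_div, le_div_iff₀ (by positivity)]
    exact h1
  have hlow : ∀ t ∈ Set.Icc η (2 * η), B⁻¹ ≤ v t := by
    intro t ht
    have hdiff : ∀ x ∈ (Set.univ : Set ℝ), DifferentiableAt ℝ v x := fun x _ =>
      ((evenEigenfunction_contDiff n k).differentiable (by simp)) x
    have hlip := convex_univ.norm_image_sub_le_of_norm_deriv_le hdiff (C := C ^ (k + 2))
      (fun x _ => by simpa [iteratedDeriv_one] using hC k 0 1 x) (Set.mem_univ 0) (Set.mem_univ t)
    have ht0 : 0 ≤ t := hη0.le.trans ht.1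
    rw [sub_zero, Real.norm_eq_abs, Real.norm_of_nonneg ht0] at hlip
    have h1 := (abs_le.mp hlip).1
    have h2 : C ^ (k + 2) * t ≤ C ^ (k + 2) * (2 * η) := by
      gcongr
      exact ht.2
    have h3 := evenEigenfunction_zero_ge n k
    have h4 : (B : ℝ)⁻¹ ≤ (1 / 2) ^ (k + 1) := by
      rw [hB, ← inv_pow]
      gcongr
      rw [one_div]
      gcongr
      linarith
    have h5 : (1 / 2 : ℝ) ^ k = 2 * (1 / 2) ^ (k + 1) := by ring
    linarith
  have hint := integrable_sq_pow_mul_evenEigenfunction n k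
  calc ((((2 * C) ^ (2 * n + 2)) ^ (k + 1))⁻¹) ^ 2 = (η ^ n * B⁻¹) ^ 2 * η := by
        have hE : ((2 * C) ^ (2 * n + 2)) ^ (k + 1) = B ^ (2 * n + 2) := by
          rw [hB, ← pow_mul, ← pow_mul, mul_comm (k + 1)]
        rw [hE, hη]
        clear_value B
        rw [← inv_pow, ← inv_pow]
        ring
    _ = (η ^ n * B⁻¹) ^ 2 * MeasureTheory.volume.real (Set.Icc η (2 * η)) := by
        rw [Real.volume_real_Icc_of_le (by linarith)]
        ring
    _ ≤ ∫ t in Set.Icc η (2 * η), (t ^ n * v t) ^ 2 := by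
        refine MeasureTheory.setIntegral_ge_of_const_le_real measurableSet_Icc
          (by simp) (fun t ht => ?_) hint.integrableOn
        have := hlow t ht
        have ht0 : 0 ≤ t := hη0.le.trans ht.1
        gcongr
        exact ht.1
    _ ≤ ∫ t : ℝ, (t ^ n * v t) ^ 2 :=
        MeasureTheory.setIntegral_le_integral hint
          (Filter.Eventually.of_forall fun t => sq_nonneg _)

theorem integral_sq_pow_mul_evenEigenfunction_pos (n k : ℕ) :
    0 < ∫ t : ℝ, (t ^ n * evenEigenfunction n k t) ^ 2 := by
  obtain ⟨c, hc1, hc⟩ := integral_sq_pow_mul_evenEigenfunction_ge n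
  have hc0 : 0 < c := by linarith
  exact lt_of_lt_of_le (by positivity) (hc k)

theorem integral_sq_pow_mul_normalizedEvenEigenfunction (n k : ℕ) :
    ∫ t : ℝ, (t ^ n * normalizedEvenEigenfunction n k t) ^ 2 = 1 := by
  have hpos := integral_sq_pow_mul_evenEigenfunction_pos n k
  have h : ∀ t : ℝ, (t ^ n * normalizedEvenEigenfunction n k t) ^ 2 =
      (t ^ n * evenEigenfunction n k t) ^ 2 /
        ∫ s : ℝ, (s ^ n * evenEigenfunction n k s) ^ 2 := by
    intro t
    rw [normalizedEvenEigenfunction, ← mul_div_assoc, div_pow, Real.sq_sqrt hpos.le]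
  simp_rw [h]
  rw [MeasureTheory.integral_div, div_self hpos.ne']

theorem abs_pow_mul_iteratedDeriv_normalizedEvenEigenfunction_le (n : ℕ) :
    ∃ C : ℝ, 1 ≤ C ∧ ∀ (k p q : ℕ) (t : ℝ),
      |t ^ p * iteratedDeriv q (normalizedEvenEigenfunction n k) t| ≤
        C ^ (k + p + q + 1) * (p ! : ℝ) ^ (1 / (2 * (n : ℝ) + 2)) *
          (q ! : ℝ) ^ ((2 * (n : ℝ) + 1) / (2 * (n : ℝ) + 2)) := by
  obtain ⟨C, hC1, hC⟩ := abs_pow_mul_iteratedDeriv_evenEigenfunction_le n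
  obtain ⟨c, hc1, hc⟩ := integral_sq_pow_mul_evenEigenfunction_ge n
  have hc0 : 0 < c := by linarith
  refine ⟨C * c, one_le_mul_of_one_le_of_one_le hC1 hc1, fun k p q t => ?_⟩
  have hN : (c ^ (k + 1))⁻¹ ≤ √(∫ s : ℝ, (s ^ n * evenEigenfunction n k s) ^ 2) :=
    Real.le_sqrt_of_sq_le (hc k)
  have hN0 : 0 < √(∫ s : ℝ, (s ^ n * evenEigenfunction n k s) ^ 2) :=
    lt_of_lt_of_le (by positivity) hN
  have hf : normalizedEvenEigenfunction n k = fun t => evenEigenfunction n k t /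
      √(∫ s : ℝ, (s ^ n * evenEigenfunction n k s) ^ 2) := rfl
  rw [hf, iteratedDeriv_div_const, ← mul_div_assoc, abs_div, abs_of_pos hN0, div_eq_mul_inv]
  calc _ ≤ (C ^ (k + p + q + 1) * (p ! : ℝ) ^ (1 / (2 * (n : ℝ) + 2)) *
          (q ! : ℝ) ^ ((2 * (n : ℝ) + 1) / (2 * (n : ℝ) + 2))) * c ^ (k + 1) := by
        refine mul_le_mul (hC k p q t) ?_ (by positivity) (by positivity)
        exact inv_le_of_inv_le₀ (by positivity) hN
    _ ≤ (C ^ (k + p + q + 1) * (p ! : ℝ) ^ (1 / (2 * (n : ℝ) + 2)) *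
          (q ! : ℝ) ^ ((2 * (n : ℝ) + 1) / (2 * (n : ℝ) + 2))) * c ^ (k + p + q + 1) := by
        gcongr
        omega
    _ = _ := by
        rw [mul_pow]
        ring

/-! ### Membership in the Gel'fand–Shilov space -/

theorem factorial_rpow_le (p : ℕ) {a : ℝ} (ha : 0 ≤ a) :
    (p ! : ℝ) ^ a ≤ (p : ℝ) ^ (a * (p : ℝ)) := by
  rw [mul_comm, Real.rpow_mul (by positivity), Real.rpow_natCast]
  exact Real.rpow_le_rpow (by positivity) (by exact_mod_cast Nat.factorial_le_pow p) ha

theorem mem_gelfandShilov_of_factorial_bound {a b C K : ℝ} {f : ℝ → ℝ} (ha : 0 ≤ a) (hb : 0 ≤ b)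
    (hf : ContDiff ℝ ∞ f) (hC : 0 < C) (hK : 0 < K)
    (h : ∀ (p q : ℕ) (t : ℝ), |t ^ p * iteratedDeriv q f t| ≤
      K * C ^ (p + q) * (p ! : ℝ) ^ a * (q ! : ℝ) ^ b) :
    f ∈ gelfandShilov a b := by
  refine ⟨hf, K, C, C, hK, hC, hC, fun p q t => (h p q t).trans ?_⟩
  rw [pow_add, ← mul_assoc]
  gcongr
  · exact factorial_rpow_le p ha
  · exact factorial_rpow_le q hb

theorem evenEigenfunction_decay (n k : ℕ) :
    ∃ c : ℝ, 0 < c ∧ ∃ M : ℝ, ∀ t, |evenEigenfunction n k t| ≤ M * Real.exp (-(c * |t|)) := by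
  obtain ⟨D, hD1, hD⟩ := abs_iteratedDeriv_evenEigenfunction_le n
  have h8 : (0 : ℝ) < 8 * (n : ℝ) + 8 := by positivity
  refine ⟨1 / (8 * (n : ℝ) + 8), by positivity,
    D ^ (k + 1) * Real.exp (1 / (8 * (n : ℝ) + 8)), fun t => ?_⟩
  have h := hD k 0 t
  simp only [iteratedDeriv_zero, Nat.factorial_zero, Nat.cast_one, Real.one_rpow, mul_one,
    add_zero] at h
  refine h.trans ?_
  rw [mul_assoc, ← Real.exp_add]
  gcongr
  have ht : |t| ≤ t ^ (2 * n + 2) + 1 := by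
    have heven : Even (2 * n + 2) := ⟨n + 1, by ring⟩
    rw [← heven.pow_abs t]
    rcases le_total 1 |t| with h1 | h1
    · have := le_self_pow₀ h1 (by omega : 2 * n + 2 ≠ 0)
      linarith
    · have : 0 ≤ |t| ^ (2 * n + 2) := by positivity
      linarith
  have h3 := div_le_div_of_nonneg_right ht h8.le
  rw [add_div] at h3
  rw [one_div_mul_eq_div]
  linarith

theorem isEvenEigenfunction_evenEigenfunction (n k : ℕ) :
    IsEvenEigenfunction n (4 * (k : ℝ) * ((n : ℝ) + 1) + 2 * (n : ℝ) + 1)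
      (evenEigenfunction n k) where
  smooth := evenEigenfunction_contDiff n k
  even := evenEigenfunction_neg n k
  ne_zero h := by
    have h0 := evenEigenfunction_zero_ge n k
    rw [h, Pi.zero_apply] at h0
    have : (0 : ℝ) < (1 / 2) ^ k := by positivity
    linarith
  equation := evenEigenfunction_ode n k
  decay := evenEigenfunction_decay n k

theorem theorem5p1p1 (n : ℕ) :
    (∀ k : ℕ,
      IsEvenEigenfunction n (4 * (k : ℝ) * ((n : ℝ) + 1) + 2 * (n : ℝ) + 1)
        (evenEigenfunction n k) ∧
      ∫ t : ℝ, (t ^ n * normalizedEvenEigenfunction n k t) ^ 2 = 1) ∧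
    (∀ k : ℕ,
      evenEigenfunction n k ∈
        gelfandShilov (1 / (2 * (n : ℝ) + 2)) ((2 * (n : ℝ) + 1) / (2 * (n : ℝ) + 2)) ∧
      normalizedEvenEigenfunction n k ∈
        gelfandShilov (1 / (2 * (n : ℝ) + 2)) ((2 * (n : ℝ) + 1) / (2 * (n : ℝ) + 2))) ∧
    ∃ C : ℝ, 0 < C ∧ ∀ (k α β : ℕ) (t : ℝ),
      |t ^ α * iteratedDeriv β (evenEigenfunction n k) t| ≤
        C ^ (k + α + β + 1) * (α ! : ℝ) ^ (1 / (2 * (n : ℝ) + 2)) *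
          (β ! : ℝ) ^ ((2 * (n : ℝ) + 1) / (2 * (n : ℝ) + 2)) ∧
      |t ^ α * iteratedDeriv β (normalizedEvenEigenfunction n k) t| ≤
        C ^ (k + α + β + 1) * (α ! : ℝ) ^ (1 / (2 * (n : ℝ) + 2)) *
          (β ! : ℝ) ^ ((2 * (n : ℝ) + 1) / (2 * (n : ℝ) + 2)) := by

  obtain ⟨C, hC1, hC⟩ := abs_pow_mul_iteratedDeriv_evenEigenfunction_le n
  obtain ⟨C', hC1', hC'⟩ := abs_pow_mul_iteratedDeriv_normalizedEvenEigenfunction_le n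
  have hC0 : 0 < C := by linarith
  have hC0' : 0 < C' := by linarith
  have ha : 0 ≤ 1 / (2 * (n : ℝ) + 2) := by positivity
  have hb : 0 ≤ (2 * (n : ℝ) + 1) / (2 * (n : ℝ) + 2) := by positivity
  refine ⟨fun k => ⟨isEvenEigenfunction_evenEigenfunction n k,
    integral_sq_pow_mul_normalizedEvenEigenfunction n k⟩, fun k => ⟨?_, ?_⟩,
    max C C', by positivity, fun k p q t => ⟨?_, ?_⟩⟩
  · refine mem_gelfandShilov_of_factorial_bound (K := C ^ (k + 1)) ha hb
      (evenEigenfunction_contDiff n k) hC0 (by positivity) fun p q t => (hC k p q t).trans_eq ?_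
    ring
  · refine mem_gelfandShilov_of_factorial_bound (K := C' ^ (k + 1)) ha hb
      ((evenEigenfunction_contDiff n k).div_const _) hC0' (by positivity)
      fun p q t => (hC' k p q t).trans_eq ?_
    ring
  · refine (hC k p q t).trans ?_
    gcongr
    exact le_max_left C C'
  · refine (hC' k p q t).trans ?_
    gcongr
    exact le_max_right C C'
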